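/- Let $\mathbb N=\{1,2,\dots\}$. Let $\alpha=(\alpha_k)_{k\ge1}$ be a sequence in $\{1,2,\dots\}\cup\{+\infty\}$ that is strictly increasing as long as it is finite and stays $+\infty$ once it is $+\infty$ (so it is an infinite strictly increasing sequence of positive integers, or has only finitely many finite terms), with $\sum_k 1/\alpha_k<\infty$, where $1/\infty=0$. Let $G=\{\alpha_k+1:\alpha_k<\infty\}$ and let $\beta_1<\beta_2<\dots$ be the elements of $\mathbb N\setminus G$. For a bijection $\sigma:\mathbb N\to\mathbb N$ let $r_i(\sigma)=|\{j\le i:\sigma(j)\le\sigma(i)\}|$ be the rank of $\sigma(i)$ among $\sigma(1),\dots,\sigma(i)$. Consider the law of a sequence $(r_i)_{i\ge1}$ of independent random variables with $r_i=i$ for $i\notin G$ and $r_i$ uniformly distributed on $\{1,\dots,i-1\}$ for $i\in G$. Let $P^{(\alpha,1)}$ be the law of the random bijection $\sigma$ of $\mathbb N$ with ranks $r_i(\sigma)=r_i$, on the $\sigma$-algebra generated by the events $\{\sigma(i)=j\}$. Let $\triangleleft$ be the strict order on $\mathbb N$ generated by the relations $\beta_1\triangleleft\beta_2\triangleleft\cdots$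 and $g\triangleleft\max\{\beta_k:\beta_k<g\}$ for $g\in G$. A causal set $(\mathbb N,\triangleleft)$ is a strict partial order on $\mathbb N$ in which every element is preceded by only finitely many others. A natural extension of it is a bijection $\sigma:\mathbb N\to\mathbb N$ such that $i\triangleleft j$ implies $\sigma(i)<\sigma(j)$, i.e. the enumeration $\sigma^{-1}(1),\sigma^{-1}(2),\dots$ lists $i$ before $j$. A stem is a finite sequence $(j_1,\dots,j_k)$ with $\sigma^{-1}(1)=j_1,\dots,\sigma^{-1}(k)=j_k$ for some natural extension $\sigma$. A probability measure $P$ on the bijections of $\mathbb N$ is order-invariant for $(\mathbb N,\triangleleft)$ if it is concentrated on the natural extensions and $$P(\sigma^{-1}(1)=j_1,\dots,\sigma^{-1}(k)=j_k)=P(\sigma^{-1}(1)=\ell_1,\dots,\sigma^{-1}(k)=\ell_k)$$ for all $k$ and all stems $(j_1,\dots,j_k)$, $(\ell_1,\dots,\ell_k)$ with $\{j_1,\dots,j_k\}=\{\ell_1,\dots,\ell_k\}$. Proposition. $(\mathbb N,\triangleleft)$ is a causal set; almost surely $(r_i)$ is the rank sequence of exactly one bijection of $\mathbb N$, so that $P^{(\alpha,1)}$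 is well defined; and $P^{(\alpha,1)}$ is the unique order-invariant measure for $(\mathbb N,\triangleleft)$. -/

import Mathlib

open MeasureTheory
open scoped ENNReal

/-! Positive integers are `ℕ+`. Permutations `σ` of `ℕ+` are read as words `σ 1, σ 2, …`; the elements
of the causal sets below are the positions, and `σ.symm 1, σ.symm 2, …` lists the positions in the
order of their letters. -/

namespace CausalRecords

section General

/-- The sigma-algebra on the permutations of `ℕ+` generated by the events `σ i = j`
(equivalently, by the events `σ.symm j = i`). -/
instance permMeasurableSpace : MeasurableSpace (Equiv.Perm ℕ+) :=
  MeasurableSpace.generateFrom {s | ∃ i j : ℕ+, s = {σ : Equiv.Perm ℕ+ | σ i = j}}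

/-- A strict partial order on `ℕ+` in which every element has finitely many predecessors. -/
structure IsCausalSet (r : ℕ+ → ℕ+ → Prop) : Prop where
  irrefl : ∀ i, ¬ r i i
  trans : ∀ i j k, r i j → r j k → r i k
  finite_past : ∀ j, {i | r i j}.Finite

/-- `σ` is a natural extension of `r`: the enumeration `σ.symm 1, σ.symm 2, …` of `ℕ+` lists
`i` before `j` whenever `r i j`. -/
def IsNaturalExtension (r : ℕ+ → ℕ+ → Prop) (σ : Equiv.Perm ℕ+) : Prop :=
  ∀ i j, r i j → σ i < σ j

/-- The event `σ⁻¹(1) = j₁, …, σ⁻¹(k) = j_k`; here `j l` stands for `j_{l+1}`. -/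
def stemEvent {k : ℕ} (j : Fin k → ℕ+) : Set (Equiv.Perm ℕ+) :=
  {σ | ∀ l : Fin k, σ.symm (Nat.succPNat l) = j l}

/-- `j₁, …, j_k` is a stem: an initial segment of some natural extension. -/
def IsStem (r : ℕ+ → ℕ+ → Prop) {k : ℕ} (j : Fin k → ℕ+) : Prop :=
  ∃ σ : Equiv.Perm ℕ+, IsNaturalExtension r σ ∧ σ ∈ stemEvent j

/-- Order-invariant measures: probability measures carried by the natural extensions of `r`, for
which the probability of a stem depends only on its underlying set. -/
structure IsOrderInvariant (r : ℕ+ → ℕ+ → Prop) (P : Measure (Equiv.Perm ℕ+)) : Prop where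
  isProbabilityMeasure : IsProbabilityMeasure P
  ae_isNaturalExtension : ∀ᵐ σ ∂P, IsNaturalExtension r σ
  stem_eq : ∀ (k : ℕ) (j l : Fin k → ℕ+), IsStem r j → IsStem r l →
    Set.range j = Set.range l → P (stemEvent j) = P (stemEvent l)

/-- The rank sequence of `σ`: `rankSeq σ i` is the rank of `σ i` among `σ 1, …, σ i`. -/
def rankSeq (σ : Equiv.Perm ℕ+) (i : ℕ+) : ℕ :=
  ((Finset.Icc 1 i).filter (fun j => σ j ≤ σ i)).card

open Classical in
/-- The permutation with rank sequence `r`, if there is one (it is then unique);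
the identity otherwise. -/
noncomputable def permOfRanks (r : ℕ+ → ℕ) : Equiv.Perm ℕ+ :=
  if h : ∃ σ : Equiv.Perm ℕ+, rankSeq σ = r then h.choose else 1

end General

section Alpha

/-- The set `{α₁ + 1, α₂ + 1, …}` (an infinite value of `α` contributes nothing). -/
def gaps (α : ℕ → ℕ∞) : Set ℕ+ :=
  {n | ∃ k, ((n : ℕ) : ℕ∞) = α k + 1}

/-- The generating relations: `b ◁ b'` for `b < b'` both in the complement `{β₁, β₂, …}` of
`gaps α`, and `g ◁ b` for `g ∈ gaps α` and `b` the largest element of that complement below `g`. -/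
inductive GapRel (α : ℕ → ℕ∞) : ℕ+ → ℕ+ → Prop
  | chain {b b' : ℕ+} (hb : b ∉ gaps α) (hb' : b' ∉ gaps α) (h : b < b') : GapRel α b b'
  | gap {g b : ℕ+} (hg : g ∈ gaps α) (hb : IsGreatest {c : ℕ+ | c ∉ gaps α ∧ c < g} b) :
      GapRel α g b

/-- The strict order `◁` generated by `GapRel α`. -/
def gapOrder (α : ℕ → ℕ∞) : ℕ+ → ℕ+ → Prop :=
  Relation.TransGen (GapRel α)

open Classical in
/-- The law of the rank `r_i`: uniform on `{1, …, i - 1}` if `i ∈ gaps α`, and the point mass at `i`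
otherwise. (`1 < i` holds for all `i ∈ gaps α` when the `α k` are positive.) -/
noncomputable def rankPMF (α : ℕ → ℕ∞) (i : ℕ+) : PMF ℕ :=
  if h : i ∈ gaps α ∧ 1 < (i : ℕ) then
    PMF.uniformOfFinset (Finset.Icc 1 ((i : ℕ) - 1))
      (Finset.nonempty_Icc.2 (Nat.le_sub_one_of_lt h.2))
  else PMF.pure (i : ℕ)

/-- The product measure on rank sequences that makes the ranks independent with laws `rankPMF`. -/
noncomputable def rankLaw (α : ℕ → ℕ∞) : Measure (ℕ+ → ℕ) :=
  Measure.infinitePi (fun i => (rankPMF α i).toMeasure)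

/-- The measure `P^{(α,1)}`: the law of the permutation whose ranks are distributed
according to `rankLaw α`. -/
noncomputable def recordMeasure (α : ℕ → ℕ∞) : Measure (Equiv.Perm ℕ+) :=
  (rankLaw α).map permOfRanks

end Alpha

end CausalRecords

/-! Inserting letters one at a time, the rank of a fixed letter never decreases and is eventually
its value. So a permutation is determined by its ranks (`rankSeq_injective`), and admissible ranks
come from a permutation once every running rank is bounded (`exists_rankSeq_eq`). Under `rankLaw`
the expected running rank grows at step `n` by a factor of at most `1 + gapWeight α n`. These
weights are distinct terms `1/α k`, so the product converges and boundedness holds almost surely.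

A permutation is a natural extension exactly when its non-records are the positions in `gaps α`
(`isNaturalExtension_gapOrder_iff`). The constraint thus falls on each rank separately, and
`recordMeasure` gives equal mass to all rank vectors of length `n` of natural extensions. This
uniformity for every `n` (`IsRankUniform`) is equivalent to order-invariance. Stems with the same
set differ by a finitely supported rearrangement of positions, which acts injectively on rank
vectors. Conversely, two patterns on `1, …, n` differ by a permutation of these positions, which
maps long stems to stems with the same set. Uniformity fixes the law of every finite rank vector,
hence the measure. -/

namespace CausalRecords

open Filter Finset

/-! ### Permutations and their rank sequences -/

section Combinatorics

/-- The rank of `σ i` among `σ 1, …, σ n`. -/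
def partialRank (σ : Equiv.Perm ℕ+) (n i : ℕ+) : ℕ :=
  ((Icc 1 n).filter (fun j => σ j ≤ σ i)).card

/-- The rank of the `i`-th letter among the first `n` letters, computed from the rank sequence. -/
def runningRank (r : ℕ+ → ℕ) (i n : ℕ+) : ℕ :=
  PNat.recOn n (r i)
    (fun m x => if i ≤ m then x + (if r (m + 1) ≤ x then 1 else 0) else x)

lemma runningRank_succ (r : ℕ+ → ℕ) (i n : ℕ+) :
    runningRank r i (n + 1) =
      if i ≤ n then runningRank r i n + (if r (n + 1) ≤ runningRank r i n then 1 else 0)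
      else runningRank r i n := by
  rw [runningRank, PNat.recOn_succ]
  rfl

/-- For `n < i` the value `r i` is a placeholder, which keeps the running rank monotone in all of
`n`. -/
lemma runningRank_of_le (r : ℕ+ → ℕ) {i n : ℕ+} (h : n ≤ i) : runningRank r i n = r i := by
  induction n using PNat.recOn with
  | one => simp [runningRank]
  | succ n ih =>
    have hn : n < i := PNat.add_one_le_iff.1 h
    rw [runningRank_succ, if_neg (not_le.2 hn), ih hn.le]

lemma runningRank_self (r : ℕ+ → ℕ) (i : ℕ+) : runningRank r i i = r i :=
  runningRank_of_le r le_rfl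

lemma runningRank_mono (r : ℕ+ → ℕ) (i : ℕ+) : Monotone (runningRank r i) := by
  intro m n hmn
  induction n using PNat.recOn with
  | one => rw [le_antisymm hmn one_le]
  | succ n ih =>
    rcases hmn.lt_or_eq with h | rfl
    · refine (ih (PNat.lt_add_one_iff.1 h)).trans ?_
      rw [runningRank_succ]
      split_ifs <;> simp
    · exact le_rfl

lemma runningRank_congr {r r' : ℕ+ → ℕ} {i n : ℕ+} (hi : i ≤ n) (h : ∀ m ≤ n, r m = r' m) :
    runningRank r i n = runningRank r' i n := by
  induction n using PNat.recOn with
  | one => simp [runningRank, h i hi]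
  | succ n ih =>
    rcases hi.lt_or_eq with h1 | rfl
    · have h2 := PNat.lt_add_one_iff.1 h1
      rw [runningRank_succ, runningRank_succ,
        ih h2 (fun m hm => h m (hm.trans (PNat.lt_add_right n 1).le)), h _ le_rfl]
    · rw [runningRank_self, runningRank_self, h _ le_rfl]

section Perm

variable (σ : Equiv.Perm ℕ+)

lemma partialRank_self (i : ℕ+) : partialRank σ i i = rankSeq σ i := rfl

lemma partialRank_le_iff {n i j : ℕ+} (hi : i ≤ n) :
    partialRank σ n i ≤ partialRank σ n j ↔ σ i ≤ σ j := by
  refine ⟨fun h => ?_, fun h => card_le_card fun u hu => ?_⟩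
  · by_contra hc
    push Not at hc
    refine absurd h (not_le.2 (card_lt_card ?_))
    rw [ssubset_iff_of_subset]
    · exact ⟨i, by simp [hi], by simp [hc]⟩
    · intro u hu
      simp only [mem_filter] at hu ⊢
      exact ⟨hu.1, hu.2.trans hc.le⟩
  · simp only [mem_filter] at hu ⊢
    exact ⟨hu.1, hu.2.trans h⟩

lemma partialRank_lt_iff {n i j : ℕ+} (hj : j ≤ n) :
    partialRank σ n i < partialRank σ n j ↔ σ i < σ j := by
  rw [← not_le, partialRank_le_iff σ hj, not_le]

lemma Icc_one_succ (n : ℕ+) : Icc 1 (n + 1) = insert (n + 1) (Icc 1 n) := by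
  ext u
  simp only [mem_Icc, one_le, true_and, mem_insert]
  rw [le_iff_lt_or_eq, PNat.lt_add_one_iff]
  tauto

lemma succ_notMem_Icc_one (n : ℕ+) : n + 1 ∉ Icc 1 n := by
  simp

lemma partialRank_succ {n i : ℕ+} :
    partialRank σ (n + 1) i = partialRank σ n i + (if σ (n + 1) ≤ σ i then 1 else 0) := by
  rw [partialRank, Icc_one_succ, filter_insert]
  split_ifs
  · rw [card_insert_of_notMem (fun h => succ_notMem_Icc_one n (mem_filter.1 h).1)]
    rfl
  · rfl

/-- A new letter below `σ i` raises the rank of `σ i` by one, so "strictly below the new rank"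
becomes "at most the old rank". -/
lemma rankSeq_succ_le_iff {n i : ℕ+} (hi : i ≤ n) :
    rankSeq σ (n + 1) ≤ partialRank σ n i ↔ σ (n + 1) ≤ σ i := by
  have hlt := PNat.lt_add_right n 1
  have hne : σ i ≠ σ (n + 1) := fun h => (hi.trans_lt hlt).ne (σ.injective h)
  have h1 := partialRank_succ σ (n := n) (i := i)
  have h2 := partialRank_le_iff σ (n := n + 1) (i := n + 1) (j := i) le_rfl
  have h3 := partialRank_lt_iff σ (n := n + 1) (i := n + 1) (j := i) (hi.trans hlt.le)
  have h4 := partialRank_lt_iff σ (n := n + 1) (i := i) (j := n + 1) le_rfl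
  rw [partialRank_self] at h2 h3 h4
  constructor
  · intro h
    rw [← h2]
    omega
  · intro h
    have h5 := h3.2 (lt_of_le_of_ne h hne.symm)
    rw [if_pos h] at h1
    omega

lemma runningRank_rankSeq {n i : ℕ+} (hi : i ≤ n) :
    runningRank (rankSeq σ) i n = partialRank σ n i := by
  induction n using PNat.recOn with
  | one => rw [le_antisymm hi one_le, runningRank_self, partialRank_self]
  | succ n ih =>
    rcases hi.lt_or_eq with h | rfl
    · have h' := PNat.lt_add_one_iff.1 h
      rw [runningRank_succ, if_pos h', ih h', partialRank_succ]
      simp only [rankSeq_succ_le_iff σ h']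
    · rw [runningRank_self, partialRank_self]

lemma partialRank_eq_of_forall_le {n i : ℕ+} (h : ∀ j, σ j ≤ σ i → j ≤ n) :
    partialRank σ n i = σ i := by
  have : ((Icc 1 n).filter (fun j => σ j ≤ σ i)) = (Icc 1 (σ i)).map σ.symm.toEmbedding := by
    ext u
    simp only [mem_filter, mem_Icc, one_le, true_and, mem_map_equiv, Equiv.symm_symm]
    exact ⟨fun hu => hu.2, fun hu => ⟨h u hu, hu⟩⟩
  rw [partialRank, this, card_map, PNat.card_Icc]
  simp

lemma eventually_partialRank_eq (i : ℕ+) : ∀ᶠ n in atTop, partialRank σ n i = σ i := by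
  have hfin : {j | σ j ≤ σ i}.Finite :=
    (Set.finite_Iic (σ i)).preimage σ.injective.injOn
  obtain ⟨N, hN⟩ := hfin.bddAbove
  filter_upwards [eventually_ge_atTop N] with n hn
  exact partialRank_eq_of_forall_le σ fun j hj => (hN hj).trans hn

lemma eventually_runningRank_rankSeq (i : ℕ+) :
    ∀ᶠ n in atTop, runningRank (rankSeq σ) i n = σ i := by
  filter_upwards [eventually_partialRank_eq σ i, eventually_ge_atTop i] with n hn hi
  rw [runningRank_rankSeq σ hi, hn]

lemma rankSeq_pos (i : ℕ+) : 1 ≤ rankSeq σ i :=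
  card_pos.2 ⟨i, by simp⟩

lemma rankSeq_le (i : ℕ+) : rankSeq σ i ≤ i := by
  refine (card_filter_le _ _).trans ?_
  simp

lemma rankSeq_eq_self_iff (i : ℕ+) : rankSeq σ i = i ↔ ∀ j ≤ i, σ j ≤ σ i := by
  have h : (i : ℕ) = (Icc 1 i).card := by simp
  rw [h, rankSeq, card_filter_eq_iff]
  simp

end Perm

/-- Each letter is the eventual value of a running rank, which depends on the rank sequence alone.
-/
lemma rankSeq_injective : Function.Injective rankSeq := by
  intro σ σ' h
  refine Equiv.ext fun i => ?_
  have h1 := eventually_runningRank_rankSeq σ i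
  have h2 := eventually_runningRank_rankSeq σ' i
  rw [h] at h1
  obtain ⟨n, h3, h4⟩ := (h1.and h2).exists
  exact_mod_cast h3.symm.trans h4

lemma permOfRanks_rankSeq (σ : Equiv.Perm ℕ+) : permOfRanks (rankSeq σ) = σ := by
  have h : ∃ τ : Equiv.Perm ℕ+, rankSeq τ = rankSeq σ := ⟨σ, rfl⟩
  rw [permOfRanks, dif_pos h]
  exact rankSeq_injective h.choose_spec

/-- Two permutations have the same ranks up to `n` iff they induce the same order on `1, …, n`. -/
lemma rankSeq_eqOn_iff {σ σ' : Equiv.Perm ℕ+} {n : ℕ+} :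
    (∀ m ≤ n, rankSeq σ m = rankSeq σ' m) ↔
      ∀ i ≤ n, ∀ j ≤ n, (σ i < σ j ↔ σ' i < σ' j) := by
  constructor
  · intro h i hi j hj
    rw [← partialRank_lt_iff σ hj, ← partialRank_lt_iff σ' hj, ← runningRank_rankSeq σ hi,
      ← runningRank_rankSeq σ hj, ← runningRank_rankSeq σ' hi, ← runningRank_rankSeq σ' hj,
      runningRank_congr hi h, runningRank_congr hj h]
  · intro h m hm
    refine congrArg card (filter_congr fun j hj => ?_)
    have hj' : j ≤ n := (mem_Icc.1 hj).2.trans hm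
    rw [← not_lt, ← not_lt, h m hm j hj']

/-! ### Which sequences are rank sequences -/

section Admissible

variable {r : ℕ+ → ℕ} (hr : ∀ i, 1 ≤ r i ∧ r i ≤ i)
include hr

lemma runningRank_pos (i n : ℕ+) : 1 ≤ runningRank r i n := by
  rcases le_total n i with h | h
  · rw [runningRank_of_le r h]
    exact (hr i).1
  · refine (hr i).1.trans ?_
    rw [← runningRank_self r i]
    exact runningRank_mono r i h

lemma runningRank_le {i n : ℕ+} (hi : i ≤ n) : runningRank r i n ≤ n := by
  induction n using PNat.recOn with
  | one => rw [le_antisymm hi one_le, runningRank_self]; exact (hr 1).2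
  | succ n ih =>
    rcases hi.lt_or_eq with h | rfl
    · have h' := PNat.lt_add_one_iff.1 h
      have := ih h'
      rw [runningRank_succ, if_pos h', PNat.add_coe, PNat.one_coe]
      split_ifs <;> omega
    · rw [runningRank_self]
      exact (hr _).2

omit hr in
-- An insertion that lifts the smaller of two ranks also lifts the larger, so relative order is
-- permanent.
lemma runningRank_lt_of_lt {i j m n : ℕ+} (hi : i ≤ m) (hj : j ≤ m) (hmn : m ≤ n)
    (h : runningRank r i m < runningRank r j m) : runningRank r i n < runningRank r j n := by
  induction n using PNat.recOn with
  | one => rwa [← le_antisymm hmn one_le]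
  | succ n ih =>
    rcases hmn.lt_or_eq with h1 | rfl
    · have h' := PNat.lt_add_one_iff.1 h1
      have := ih h'
      rw [runningRank_succ, runningRank_succ, if_pos (hi.trans h'), if_pos (hj.trans h')]
      split_ifs <;> omega
    · exact h

omit hr in
lemma runningRank_ne_of_lt {i j n : ℕ+} (hij : i < j) (hj : j ≤ n) :
    runningRank r i n ≠ runningRank r j n := by
  have key : runningRank r i j ≠ runningRank r j j := by
    obtain ⟨m, rfl⟩ := PNat.exists_eq_succ_of_ne_one (one_lt_of_gt hij).ne'
    rw [runningRank_self, runningRank_succ, if_pos (PNat.lt_add_one_iff.1 hij)]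
    split_ifs <;> omega
  rcases key.lt_or_gt with h | h
  · exact (runningRank_lt_of_lt hij.le le_rfl hj h).ne
  · exact (runningRank_lt_of_lt le_rfl hij.le hj h).ne'

omit hr in
lemma runningRank_injOn (n : ℕ+) : Set.InjOn (fun i => runningRank r i n) (Icc 1 n : Finset ℕ+) := by
  intro i hi j hj hij
  simp only [coe_Icc, Set.mem_Icc, one_le, true_and] at hi hj
  rcases lt_trichotomy i j with h | h | h
  · exact absurd hij (runningRank_ne_of_lt h hj)
  · exact h
  · exact absurd hij.symm (runningRank_ne_of_lt h hi)

lemma image_runningRank (n : ℕ+) :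
    (Icc 1 n).image (fun i => runningRank r i n) = Icc 1 (n : ℕ) := by
  refine eq_of_subset_of_card_le (fun u hu => ?_) ?_
  · obtain ⟨i, hi, rfl⟩ := mem_image.1 hu
    exact mem_Icc.2 ⟨runningRank_pos hr i n, runningRank_le hr (mem_Icc.1 hi).2⟩
  · rw [card_image_of_injOn (runningRank_injOn n)]
    simp

lemma exists_runningRank_eq {n : ℕ+} {u : ℕ} (h1 : 1 ≤ u) (h2 : u ≤ n) :
    ∃ i ≤ n, runningRank r i n = u := by
  have : u ∈ (Icc 1 n).image (fun i => runningRank r i n) := by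
    rw [image_runningRank hr]
    exact mem_Icc.2 ⟨h1, h2⟩
  obtain ⟨i, hi, h⟩ := mem_image.1 this
  exact ⟨i, (mem_Icc.1 hi).2, h⟩

lemma card_filter_runningRank_le {n i : ℕ+} (hi : i ≤ n) :
    ((Icc 1 n).filter (fun j => runningRank r j n ≤ runningRank r i n)).card =
      runningRank r i n := by
  rw [← card_image_of_injOn ((runningRank_injOn (r := r) n).mono (filter_subset _ _))]
  have : (((Icc 1 n).filter (fun j => runningRank r j n ≤ runningRank r i n)).image
      (fun j => runningRank r j n)) = Icc 1 (runningRank r i n) := by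
    ext u
    simp only [mem_image, mem_filter, mem_Icc, one_le, true_and]
    constructor
    · rintro ⟨j, ⟨_, h2⟩, rfl⟩
      exact ⟨runningRank_pos hr j n, h2⟩
    · rintro ⟨h1, h2⟩
      obtain ⟨j, hj, rfl⟩ := exists_runningRank_eq hr h1 (h2.trans (runningRank_le hr hi))
      exact ⟨j, ⟨hj, h2⟩, rfl⟩
  rw [this]
  simp

/-- A sequence of ranks with bounded running ranks is the rank sequence of a permutation. -/
theorem exists_rankSeq_eq (hb : ∀ i, ∃ B, ∀ n, runningRank r i n ≤ B) :
    ∃ σ : Equiv.Perm ℕ+, rankSeq σ = r := by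
  have hlim : ∀ i, ∃ L N : ℕ+, i ≤ N ∧ ∀ n ≥ N, runningRank r i n = L := by
    intro i
    obtain ⟨B, hB⟩ := hb i
    have hbdd : BddAbove (Set.range (runningRank r i)) := ⟨B, by rintro _ ⟨n, rfl⟩; exact hB n⟩
    obtain ⟨N, hN⟩ := Nat.sSup_mem (Set.range_nonempty _) hbdd
    refine ⟨⟨runningRank r i N, runningRank_pos hr i N⟩, max i N, le_max_left _ _, fun n hn => ?_⟩
    refine le_antisymm ?_ (runningRank_mono r i ((le_max_right _ _).trans hn))
    simp only [PNat.mk_coe, hN]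
    exact le_csSup hbdd ⟨n, rfl⟩
  choose L N hiN hL using hlim
  have hlt : ∀ {i j n}, i ≤ n → j ≤ n → runningRank r i n < runningRank r j n → L i < L j := by
    intro i j n hi hj h
    have := runningRank_lt_of_lt hi hj (le_max_left n (max (N i) (N j))) h
    rw [hL i _ (by simp), hL j _ (by simp)] at this
    exact_mod_cast this
  have hinj : Function.Injective L := by
    intro i j hij
    by_contra hne
    have hne' : runningRank r i (max i j) ≠ runningRank r j (max i j) := fun h =>
      hne (runningRank_injOn (r := r) (max i j) (by simp) (by simp) h)
    rcases hne'.lt_or_gt with h | h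
    · exact (hlt (by simp) (by simp) h).ne hij
    · exact (hlt (by simp) (by simp) h).ne' hij
  have hsurj : Function.Surjective L := by
    intro u
    obtain ⟨i, hi⟩ : ∃ i, u ≤ L i := by
      by_contra! hc
      exact Set.infinite_range_of_injective hinj
        ((Set.finite_Iio u).subset (by rintro _ ⟨i, rfl⟩; exact hc i))
    -- `M` is a time by which all positions up to `N i` have stabilised.
    obtain ⟨M, hM⟩ : ∃ M, ∀ j ≤ N i, N j ≤ M :=
      ⟨(Icc 1 (N i)).sup' ⟨1, by simp⟩ N, fun j hj => le_sup' N (by simpa using hj)⟩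
    have hiM : N i ≤ M := (hiN (N i)).trans (hM _ le_rfl)
    obtain ⟨j, hjM, hj⟩ := exists_runningRank_eq hr (n := max M u) u.pos
      (by exact_mod_cast le_max_right M u)
    -- After time `N i` nothing is inserted below position `i`, since its rank is already final. A
    -- later `j` would stay above `i`, contradicting `u ≤ L i`.
    have hjN : j ≤ N i := by
      by_contra! hc
      have h1 : runningRank r i j = L i := hL i j hc.le
      have h2 : runningRank r i j < runningRank r j j := by
        refine lt_of_le_of_ne ?_ (runningRank_ne_of_lt ((hiN i).trans_lt hc) le_rfl)
        by_contra! h3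
        obtain ⟨m, rfl⟩ := PNat.exists_eq_succ_of_ne_one (one_lt_of_gt hc).ne'
        have hm := PNat.lt_add_one_iff.1 hc
        rw [runningRank_self, h1] at h3
        rw [runningRank_succ, if_pos ((hiN i).trans hm), hL i m hm, if_pos h3.le] at h1
        omega
      have h3 := runningRank_lt_of_lt ((hiN i).trans hc.le) le_rfl hjM h2
      rw [hj, hL i _ (hiM.trans (le_max_left _ _))] at h3
      exact absurd hi (not_le.2 (by exact_mod_cast h3))
    refine ⟨j, ?_⟩
    rw [hL j _ ((hM j hjN).trans (le_max_left _ _))] at hj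
    exact_mod_cast hj
  refine ⟨Equiv.ofBijective L (show Function.Bijective L from ⟨hinj, hsurj⟩), ?_⟩
  ext i
  rw [← runningRank_self r i, ← card_filter_runningRank_le hr le_rfl]
  refine congrArg card (filter_congr fun j hj => ?_)
  have hji : j ≤ i := (mem_Icc.1 hj).2
  simp only [Equiv.ofBijective_apply]
  rw [← not_lt, ← not_lt, not_iff_not]
  refine ⟨fun h => ?_, hlt le_rfl hji⟩
  by_contra! hc
  rcases hc.lt_or_eq with h' | h'
  · exact lt_asymm h (hlt hji le_rfl h')
  · rw [runningRank_injOn i (by simpa using hji) (by simp) h'] at h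
    exact lt_irrefl _ h

end Admissible

end Combinatorics

/-! ### Measurability of ranks and stems -/

section Measurability

lemma measurableSet_apply_eq (i j : ℕ+) : MeasurableSet {σ : Equiv.Perm ℕ+ | σ i = j} :=
  MeasurableSpace.measurableSet_generateFrom ⟨i, j, rfl⟩

lemma measurable_perm_apply (i : ℕ+) : Measurable (fun σ : Equiv.Perm ℕ+ => (σ i : ℕ)) := by
  refine measurable_to_countable' fun m => ?_
  rcases m.eq_zero_or_pos with rfl | hm
  · convert MeasurableSet.empty
    ext σ
    simp
  · convert measurableSet_apply_eq i ⟨m, hm⟩ using 1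
    ext σ
    exact ⟨fun h => PNat.eq h, fun h => congrArg PNat.val h⟩

lemma measurable_rankSeq : Measurable rankSeq := by
  refine measurable_pi_lambda _ fun i => ?_
  simp only [rankSeq, card_filter, ← PNat.coe_le_coe]
  refine Finset.measurable_fun_sum _ fun j _ => Measurable.ite ?_ measurable_const measurable_const
  exact measurableSet_le (measurable_perm_apply j) (measurable_perm_apply i)

lemma mem_stemEvent {k : ℕ} {j : Fin k → ℕ+} {σ : Equiv.Perm ℕ+} :
    σ ∈ stemEvent j ↔ ∀ l : Fin k, σ (j l) = Nat.succPNat l := by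
  refine forall_congr' fun l => ?_
  rw [Equiv.symm_apply_eq, eq_comm]

lemma measurableSet_stemEvent {k : ℕ} (j : Fin k → ℕ+) : MeasurableSet (stemEvent j) := by
  have : stemEvent j = ⋂ l : Fin k, {σ : Equiv.Perm ℕ+ | σ (j l) = Nat.succPNat l} := by
    ext σ
    simp [mem_stemEvent]
  rw [this]
  exact .iInter fun l => measurableSet_apply_eq _ _

/-- The first `k` terms of the enumeration given by a permutation. -/
def stemOf (k : ℕ) (σ : Equiv.Perm ℕ+) : Fin k → ℕ+ := fun l => σ.symm (Nat.succPNat l)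

lemma stemOf_preimage_singleton {k : ℕ} (j : Fin k → ℕ+) : stemOf k ⁻¹' {j} = stemEvent j := by
  ext σ
  simp [stemOf, stemEvent, funext_iff]

lemma mem_range_stemOf {k : ℕ} {σ : Equiv.Perm ℕ+} {i : ℕ+} :
    i ∈ Set.range (stemOf k σ) ↔ (σ i : ℕ) ≤ k := by
  constructor
  · rintro ⟨l, rfl⟩
    simp [stemOf]
  · intro h
    refine ⟨⟨(σ i : ℕ) - 1, by have := (σ i).pos; omega⟩, ?_⟩
    rw [stemOf, Equiv.symm_apply_eq]
    apply PNat.eq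
    have := (σ i).pos
    simp only [Nat.succPNat_coe]
    omega

lemma mem_range_of_mem_stemEvent {k : ℕ} {j : Fin k → ℕ+} {σ : Equiv.Perm ℕ+}
    (h : σ ∈ stemEvent j) {i : ℕ+} : i ∈ Set.range j ↔ (σ i : ℕ) ≤ k := by
  rw [← stemOf_preimage_singleton] at h
  rw [← mem_range_stemOf, h]

lemma measure_eq_tsum_stemEvent (μ : Measure (Equiv.Perm ℕ+)) (A : Set (Equiv.Perm ℕ+)) (k : ℕ) :
    μ A = ∑' j : Fin k → ℕ+, μ (stemEvent j ∩ A) := by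
  have h := tsum_measure_preimage_singleton (μ := μ.restrict A)
    (Set.countable_univ (α := Fin k → ℕ+)) (f := stemOf k)
    (fun j _ => by rw [stemOf_preimage_singleton]; exact measurableSet_stemEvent j)
  rw [Set.preimage_univ, Measure.restrict_apply_univ] at h
  rw [← h, ← (Equiv.Set.univ _).symm.tsum_eq]
  refine tsum_congr fun j => ?_
  rw [Equiv.Set.univ_symm_apply, stemOf_preimage_singleton,
    Measure.restrict_apply (measurableSet_stemEvent j)]

end Measurability

/-! ### Finite rank vectors and rearrangements of positions -/

section RankVec

/-- The first `n` ranks of a permutation. -/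
def rankVec (n : ℕ+) (σ : Equiv.Perm ℕ+) : Icc 1 n → ℕ := (Icc 1 n).restrict (rankSeq σ)

lemma measurable_rankVec (n : ℕ+) : Measurable (rankVec n) :=
  (Finset.measurable_restrict _).comp measurable_rankSeq

lemma rankVec_eq_iff {n : ℕ+} {σ σ' : Equiv.Perm ℕ+} :
    rankVec n σ = rankVec n σ' ↔ ∀ m ≤ n, rankSeq σ m = rankSeq σ' m := by
  simp [rankVec, funext_iff]

lemma rankVec_eq_iff_lt {n : ℕ+} {σ σ' : Equiv.Perm ℕ+} :
    rankVec n σ = rankVec n σ' ↔ ∀ i ≤ n, ∀ j ≤ n, (σ i < σ j ↔ σ' i < σ' j) := by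
  rw [rankVec_eq_iff, rankSeq_eqOn_iff]

lemma perm_le_iff {π : Equiv.Perm ℕ+} {n m : ℕ+} (hπ : ∀ i, n < i → π i = i) (hm : n ≤ m)
    (i : ℕ+) : π i ≤ m ↔ i ≤ m := by
  constructor
  · intro h
    by_contra! hc
    rw [hπ i (hm.trans_lt hc)] at h
    exact absurd h (not_le.2 hc)
  · intro h
    by_contra! hc
    have := π.injective (hπ _ (hm.trans_lt hc))
    rw [this] at hc
    exact absurd h (not_le.2 hc)

lemma inv_apply_eq_self {π : Equiv.Perm ℕ+} {i : ℕ+} (h : π i = i) : π⁻¹ i = i := by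
  rw [Equiv.Perm.inv_eq_iff_eq, h]

lemma rankVec_mul_congr {π : Equiv.Perm ℕ+} {n : ℕ+} (hπ : ∀ i, n < i → π i = i)
    {σ σ' : Equiv.Perm ℕ+} (h : rankVec n σ = rankVec n σ') :
    rankVec n (σ * π) = rankVec n (σ' * π) := by
  rw [rankVec_eq_iff_lt] at h ⊢
  intro i hi j hj
  exact h _ ((perm_le_iff hπ le_rfl i).2 hi) _ ((perm_le_iff hπ le_rfl j).2 hj)

/-- `π` fixes `i` and permutes the positions up to `i` among themselves, so the count is unchanged.
-/
lemma rankSeq_mul_of_lt {π : Equiv.Perm ℕ+} {n i : ℕ+} (hπ : ∀ i, n < i → π i = i)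
    (hi : n < i) (σ : Equiv.Perm ℕ+) : rankSeq (σ * π) i = rankSeq σ i := by
  rw [rankSeq, rankSeq, ← card_map π.toEmbedding]
  congr 1
  ext u
  have := perm_le_iff hπ hi.le (π.symm u)
  rw [π.apply_symm_apply] at this
  simp only [mem_map_equiv, mem_filter, mem_Icc, one_le, true_and, Equiv.Perm.mul_apply, hπ i hi,
    π.apply_symm_apply, this]

/-- Any two patterns on `1, …, n` differ by a permutation of `1, …, n`. -/
lemma exists_perm_pattern (σ σ' : Equiv.Perm ℕ+) (n : ℕ+) :
    ∃ π : Equiv.Perm ℕ+, (∀ i, n < i → π i = i) ∧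
      ∀ i ≤ n, ∀ j ≤ n, (σ i < σ j ↔ σ' (π i) < σ' (π j)) := by
  -- `e τ` lists the first `n` letters increasingly; `g` matches the positions of the letters of
  -- equal rank in `σ` and `σ'`.
  let e (τ : Equiv.Perm ℕ+) : Fin n ≃o (Icc 1 n).map τ.toEmbedding :=
    Finset.orderIsoOfFin _ (by simp)
  have hmem (τ : Equiv.Perm ℕ+) (i : ℕ+) : τ i ∈ (Icc 1 n).map τ.toEmbedding ↔ i ≤ n := by
    simp
  let f (τ : Equiv.Perm ℕ+) : {i // i ≤ n} ≃ (Icc 1 n).map τ.toEmbedding :=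
    τ.subtypeEquiv fun i => (hmem τ i).symm
  let g : Equiv.Perm {i // i ≤ n} :=
    (f σ).trans (((e σ).symm.trans (e σ')).toEquiv.trans (f σ').symm)
  have hg : ∀ i : {i // i ≤ n}, σ' (g i) = (e σ' ((e σ).symm (f σ i)) : ℕ+) := fun i =>
    congrArg Subtype.val ((f σ').apply_symm_apply (e σ' ((e σ).symm (f σ i))))
  refine ⟨Equiv.Perm.ofSubtype g,
    fun i hi => Equiv.Perm.ofSubtype_apply_of_not_mem g (not_le.2 hi), fun i hi j hj => ?_⟩
  rw [Equiv.Perm.ofSubtype_apply_of_mem g hi, Equiv.Perm.ofSubtype_apply_of_mem g hj, hg, hg,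
    Subtype.coe_lt_coe, OrderIso.lt_iff_lt, OrderIso.lt_iff_lt]
  rfl

end RankVec

/-! ### The order and its natural extensions -/

section Gaps

variable {α : ℕ → ℕ∞}

lemma one_notMem_gaps (hpos : ∀ k, 1 ≤ α k) : (1 : ℕ+) ∉ gaps α := by
  rintro ⟨k, hk⟩
  have h2 : ((1 : ℕ) : ℕ∞) + 1 ≤ ((1 : ℕ+) : ℕ) := by
    rw [hk]
    gcongr
    exact_mod_cast hpos k
  norm_cast at h2

lemma exists_isGreatest_gap (h1 : (1 : ℕ+) ∉ gaps α) {g : ℕ+} (hg : g ∈ gaps α) :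
    ∃ b, IsGreatest {c : ℕ+ | c ∉ gaps α ∧ c < g} b := by
  have hfin : {c : ℕ+ | c ∉ gaps α ∧ c < g}.Finite :=
    (Set.finite_Iio g).subset fun c hc => hc.2
  have hne : {c : ℕ+ | c ∉ gaps α ∧ c < g}.Nonempty :=
    ⟨1, h1, lt_of_le_of_ne one_le fun h => h1 (h ▸ hg)⟩
  obtain ⟨b, hb, hmax⟩ := hfin.exists_maximal hne
  exact ⟨b, hb, fun c hc => (le_total c b).elim id fun h => hmax hc h⟩

/-- An invariant of the generators that survives composition. The second clause gives irreflexivity;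
the third bounds the past of `j` by any later element outside `gaps α`. -/
lemma gapOrder_imp {i j : ℕ+} (h : gapOrder α i j) :
    j ∉ gaps α ∧ (i ∉ gaps α → i < j) ∧ ∀ c ∉ gaps α, c < i → c ≤ j := by
  have hstep : ∀ {i j : ℕ+}, GapRel α i j →
      j ∉ gaps α ∧ (i ∉ gaps α → i < j) ∧ ∀ c ∉ gaps α, c < i → c ≤ j := by
    rintro i j (⟨hb, hb', h⟩ | ⟨hg, hb⟩)
    · exact ⟨hb', fun _ => h, fun c _ hc => (hc.trans h).le⟩
    · exact ⟨hb.1.1, fun h => absurd hg h, fun c hc hci => hb.2 ⟨hc, hci⟩⟩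
  induction h with
  | single h => exact hstep h
  | tail _ h ih =>
    have h' := hstep h
    have hlt := h'.2.1 ih.1
    exact ⟨h'.1, fun hi => (ih.2.1 hi).trans hlt, fun c hc hci => (ih.2.2 c hc hci).trans hlt.le⟩

theorem isCausalSet_gapOrder (hinf : ∀ n : ℕ+, ∃ b > n, b ∉ gaps α) :
    IsCausalSet (gapOrder α) where
  irrefl i h := lt_irrefl i ((gapOrder_imp h).2.1 (gapOrder_imp h).1)
  trans _ _ _ := Relation.TransGen.trans
  finite_past j := by
    obtain ⟨b, hjb, hb⟩ := hinf j
    refine (Set.finite_Iic b).subset fun i hi => ?_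
    by_contra hc
    exact absurd ((gapOrder_imp hi).2.2 b hb (not_le.1 hc)) (not_le.2 hjb)

/-- A rank below `i` means that `i` is not a record. Elements outside `gaps α` lie above everything
earlier, hence are records; a gap lies below an earlier element. -/
theorem isNaturalExtension_gapOrder_iff (h1 : (1 : ℕ+) ∉ gaps α) {σ : Equiv.Perm ℕ+} :
    IsNaturalExtension (gapOrder α) σ ↔ ∀ i, i ∈ gaps α ↔ rankSeq σ i < i := by
  have hrank : ∀ i : ℕ+, rankSeq σ i < i ↔ ∃ j ≤ i, σ i < σ j := by
    intro i
    rw [(rankSeq_le σ i).lt_iff_ne, Ne, rankSeq_eq_self_iff]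
    push Not
    rfl
  simp only [hrank]
  constructor
  · intro h i
    constructor
    · intro hi
      obtain ⟨b, hb⟩ := exists_isGreatest_gap h1 hi
      exact ⟨b, hb.1.2.le, h i b (.single (.gap hi hb))⟩
    · rintro ⟨j, hji, hj⟩
      by_contra hi
      refine lt_asymm hj (h j i ?_)
      have hji' : j < i := lt_of_le_of_ne hji fun e => by simp [e] at hj
      by_cases hjg : j ∈ gaps α
      · obtain ⟨b, hb⟩ := exists_isGreatest_gap h1 hjg
        exact .tail (.single (.gap hjg hb)) (.chain hb.1.1 hi (hb.1.2.trans hji'))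
      · exact .single (.chain hjg hi hji')
  · intro h
    have hrec : ∀ b ∉ gaps α, ∀ j < b, σ j < σ b := by
      intro b hb j hj
      rw [h] at hb
      push Not at hb
      exact lt_of_le_of_ne (hb j hj.le) fun e => hj.ne (σ.injective e)
    have hstep : ∀ {i j : ℕ+}, GapRel α i j → σ i < σ j := by
      rintro i j (⟨_, hb', hlt⟩ | ⟨hg, hb⟩)
      · exact hrec j hb' i hlt
      -- The last record `j` before `i` carries the maximum so far; the non-record `i` lies below
      -- some earlier letter, hence below `σ j`.
      · have hle : ∀ c < i, σ c ≤ σ j := by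
          intro c
          induction c using PNat.strongInductionOn with
          | _ c ih =>
            intro hci
            by_cases hc : c ∈ gaps α
            · obtain ⟨d, hdc, hd⟩ := (h c).1 hc
              have hdc' : d < c := lt_of_le_of_ne hdc fun e => by simp [e] at hd
              exact hd.le.trans (ih d hdc' (hdc'.trans hci))
            · rcases (hb.2 ⟨hc, hci⟩).lt_or_eq with h' | rfl
              · exact (hrec j hb.1.1 c h').le
              · exact le_rfl
        obtain ⟨c, hci, hc⟩ := (h i).1 hg
        exact hc.trans_le (hle c (lt_of_le_of_ne hci fun e => by simp [e] at hc))
    intro i j hij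
    induction hij with
    | single h => exact hstep h
    | tail _ h ih => exact ih.trans (hstep h)

end Gaps

/-! ### Exchanging stems with the same underlying set -/

section Stems

lemma eqOn_of_mem_stemEvent {k : ℕ} {j : Fin k → ℕ+} {σ τ : Equiv.Perm ℕ+}
    (hσ : σ ∈ stemEvent j) (hτ : τ ∈ stemEvent j) {i : ℕ+} (hi : i ∈ Set.range j) : σ i = τ i := by
  obtain ⟨l, rfl⟩ := hi
  rw [mem_stemEvent.1 hσ, mem_stemEvent.1 hτ]

lemma mul_inv_mem_stemEvent {k : ℕ} {j : Fin k → ℕ+} {σ : Equiv.Perm ℕ+} (π : Equiv.Perm ℕ+)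
    (hσ : σ ∈ stemEvent j) : σ * π⁻¹ ∈ stemEvent (π ∘ j) := by
  rw [mem_stemEvent] at hσ ⊢
  intro l
  simp [hσ l]

/-- Two stems with the same underlying set are exchanged by a finitely supported permutation that
respects natural extensions. -/
lemma exists_perm_stem {r : ℕ+ → ℕ+ → Prop} {k : ℕ} {j l : Fin k → ℕ+} (hj : IsStem r j)
    (hl : IsStem r l) (h : Set.range j = Set.range l) :
    ∃ (π : Equiv.Perm ℕ+) (M : ℕ+), (∀ i, M < i → π i = i) ∧ (∀ i ∈ Set.range l, i ≤ M) ∧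
      ∀ τ, IsNaturalExtension r τ → τ ∈ stemEvent j →
        IsNaturalExtension r (τ * π⁻¹) ∧ τ * π⁻¹ ∈ stemEvent l := by
  obtain ⟨σ, -, hσ⟩ := hj
  obtain ⟨σ', hσ'r, hσ'⟩ := hl
  have hS : ∀ i, i ∈ Set.range l ↔ (σ' i : ℕ) ≤ k := fun i => mem_range_of_mem_stemEvent hσ'
  have hS' : ∀ i, i ∈ Set.range l ↔ (σ i : ℕ) ≤ k := fun i => by
    rw [← h, mem_range_of_mem_stemEvent hσ]
  have hf : ∀ i, (σ'⁻¹ * σ) i ∈ Set.range l ↔ i ∈ Set.range l := fun i => by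
    rw [hS, hS', Equiv.Perm.mul_apply, ← Equiv.Perm.mul_apply, mul_inv_cancel, Equiv.Perm.one_apply]
  let π : Equiv.Perm ℕ+ := Equiv.Perm.ofSubtype ((σ'⁻¹ * σ).subtypePerm (p := (· ∈ Set.range l)) hf)
  have hπ1 : ∀ i ∈ Set.range l, σ' (π i) = σ i := fun i hi => by
    simp only [π]
    rw [Equiv.Perm.ofSubtype_apply_of_mem _ hi]
    simp
  have hπ2 : ∀ i ∉ Set.range l, π i = i := fun i hi => Equiv.Perm.ofSubtype_apply_of_not_mem _ hi
  have hπ3 : ∀ i ∈ Set.range l, π i ∈ Set.range l := fun i hi => by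
    rw [hS, hπ1 i hi, ← hS']
    exact hi
  have hπ4 : ∀ i, π⁻¹ i ∈ Set.range l ↔ i ∈ Set.range l := fun i => by
    constructor
    · intro hi
      simpa using hπ3 _ hi
    · intro hi
      by_contra hc
      have := hπ2 _ hc
      rw [← Equiv.Perm.mul_apply, mul_inv_cancel, Equiv.Perm.one_apply] at this
      exact hc (this ▸ hi)
  obtain ⟨M, hM⟩ := (Set.finite_range l).bddAbove
  refine ⟨π, M, fun i hi => hπ2 i fun hc => absurd (hM hc) (not_le.2 hi), fun i hi => hM hi,
    fun τ hτr hτ => ?_⟩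
  -- The new permutation is `σ'` on the stem's set and `τ` off it. The set is closed under
  -- predecessors and carries exactly the letters up to `k`, so the two pieces glue to a natural
  -- extension.
  have hin : ∀ i ∈ Set.range l, (τ * π⁻¹) i = σ' i := fun i hi => by
    have hi' := (hπ4 i).2 hi
    rw [Equiv.Perm.mul_apply, eqOn_of_mem_stemEvent hτ hσ (h ▸ hi'), ← hπ1 _ hi',
      ← Equiv.Perm.mul_apply π, mul_inv_cancel, Equiv.Perm.one_apply]
  have hout : ∀ i ∉ Set.range l, (τ * π⁻¹) i = τ i := fun i hi => by
    rw [Equiv.Perm.mul_apply, inv_apply_eq_self (hπ2 i hi)]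
  have hτS : ∀ i, i ∈ Set.range l ↔ (τ i : ℕ) ≤ k := fun i => by
    rw [← h, mem_range_of_mem_stemEvent hτ]
  refine ⟨fun u v huv => ?_, ?_⟩
  · by_cases hv : v ∈ Set.range l
    · have hu : u ∈ Set.range l := by
        have h1 : (σ' u : ℕ) < σ' v := hσ'r u v huv
        rw [hS] at hv ⊢
        omega
      rw [hin u hu, hin v hv]
      exact hσ'r u v huv
    · rw [hout v hv]
      by_cases hu : u ∈ Set.range l
      · rw [hin u hu]
        rw [hτS] at hv
        rw [hS] at hu
        exact PNat.coe_lt_coe _ _ |>.1 (by omega)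
      · rw [hout u hu]
        exact hτr u v huv
  · rw [mem_stemEvent] at hσ' ⊢
    intro m
    rw [hin _ ⟨m, rfl⟩, hσ' m]

/-- The pattern of `τ * π⁻¹` on `1, …, n` determines that of `τ`, so one chosen representative per
vector gives an injection. -/
lemma encard_image_rankVec_le {A A' : Set (Equiv.Perm ℕ+)} {π : Equiv.Perm ℕ+} {n : ℕ+}
    (hπ : ∀ i, n < i → π i = i) (h : ∀ τ ∈ A, τ * π⁻¹ ∈ A') :
    (rankVec n '' A).encard ≤ (rankVec n '' A').encard := by
  have hinv : ∀ s ∈ rankVec n '' A, rankVec n (Function.invFunOn (rankVec n) A s) = s ∧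
      Function.invFunOn (rankVec n) A s ∈ A :=
    fun s hs => ⟨Function.invFunOn_eq hs, Function.invFunOn_mem hs⟩
  refine Set.encard_le_encard_of_injOn
    (f := fun s => rankVec n (Function.invFunOn (rankVec n) A s * π⁻¹)) (fun s hs => ?_) ?_
  · exact ⟨_, h _ (hinv s hs).2, rfl⟩
  · intro s hs t ht hst
    have := rankVec_mul_congr hπ hst
    rw [inv_mul_cancel_right, inv_mul_cancel_right] at this
    rw [← (hinv s hs).1, ← (hinv t ht).1, this]

end Stems

/-! ### Order-invariance is uniformity of rank vectors -/

section Uniform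

variable {r : ℕ+ → ℕ+ → Prop}

/-- All rank vectors of length `n` of natural extensions have the same probability. -/
def IsRankUniform (r : ℕ+ → ℕ+ → Prop) (μ : Measure (Equiv.Perm ℕ+)) (n : ℕ+) : Prop :=
  ∀ σ σ', IsNaturalExtension r σ → IsNaturalExtension r σ' →
    μ (rankVec n ⁻¹' {rankVec n σ}) = μ (rankVec n ⁻¹' {rankVec n σ'})

lemma measurableSet_preimage_rankVec (n : ℕ+) (B : Set (Icc 1 n → ℕ)) :
    MeasurableSet (rankVec n ⁻¹' B) :=
  measurable_rankVec n (Set.to_countable B).measurableSet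

lemma IsRankUniform.measure_preimage_image {μ : Measure (Equiv.Perm ℕ+)} {n : ℕ+}
    (hμ : IsRankUniform r μ n) {σ : Equiv.Perm ℕ+} (hσ : IsNaturalExtension r σ)
    {A : Set (Equiv.Perm ℕ+)} (hA : ∀ τ ∈ A, IsNaturalExtension r τ) :
    μ (rankVec n ⁻¹' (rankVec n '' A)) =
      (rankVec n '' A).encard * μ (rankVec n ⁻¹' {rankVec n σ}) := by
  rw [← tsum_measure_preimage_singleton (Set.to_countable _)
    (fun y _ => measurableSet_preimage_rankVec n {y})]
  rw [Set.encard, ← ENNReal.tsum_const]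
  refine tsum_congr ?_
  rintro ⟨_, τ, hτ, rfl⟩
  exact hμ τ σ (hA τ hτ) hσ

/-- Rank cylinders over the natural extensions in the stem event of `l` decrease into that event.
For large `n` they contain at least as many rank vectors as those for `j`, all of equal mass. -/
lemma stemEvent_le_of_isRankUniform {μ : Measure (Equiv.Perm ℕ+)} [IsProbabilityMeasure μ]
    (hae : ∀ᵐ σ ∂μ, IsNaturalExtension r σ) (hμ : ∀ n, IsRankUniform r μ n)
    {k : ℕ} {j l : Fin k → ℕ+} (hj : IsStem r j) (hl : IsStem r l)
    (h : Set.range j = Set.range l) : μ (stemEvent j) ≤ μ (stemEvent l) := by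
  obtain ⟨π, M, hπ, hM, hT⟩ := exists_perm_stem hj hl h
  obtain ⟨σ, hσ, -⟩ := hj
  set A := {τ | IsNaturalExtension r τ ∧ τ ∈ stemEvent j}
  set A' := {τ | IsNaturalExtension r τ ∧ τ ∈ stemEvent l}
  have hanti : Antitone fun n => rankVec n ⁻¹' (rankVec n '' A') := by
    rintro m n hmn τ ⟨τ', hτ', he⟩
    refine ⟨τ', hτ', ?_⟩
    rw [rankVec_eq_iff] at he ⊢
    exact fun i hi => he i (hi.trans hmn)
  have hle : ∀ n ≥ M, μ (stemEvent j) ≤ μ (rankVec n ⁻¹' (rankVec n '' A')) := by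
    intro n hn
    calc μ (stemEvent j) ≤ μ (rankVec n ⁻¹' (rankVec n '' A)) := by
          refine measure_mono_ae ?_
          filter_upwards [hae] with τ hτ hτj
          exact ⟨τ, ⟨hτ, hτj⟩, rfl⟩
      _ ≤ μ (rankVec n ⁻¹' (rankVec n '' A')) := by
          rw [(hμ n).measure_preimage_image hσ fun τ hτ => hτ.1,
            (hμ n).measure_preimage_image hσ fun τ hτ => hτ.1]
          refine mul_le_mul' (ENat.toENNReal_le.2 ?_) le_rfl
          exact encard_image_rankVec_le (fun i hi => hπ i (hn.trans_lt hi))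
            fun τ (hτ : τ ∈ A) => hT τ hτ.1 hτ.2
  -- At a large `n` the rank of position `l m` is final for `τ`. It is final for `τ'` too, since all
  -- letters of `τ'` up to `k` sit at positions at most `M`.
  have hsub : ⋂ n, rankVec n ⁻¹' (rankVec n '' A') ⊆ stemEvent l := by
    intro τ hτ
    rw [mem_stemEvent]
    intro m
    obtain ⟨n, hn, hnM⟩ := ((eventually_partialRank_eq τ (l m)).and (eventually_ge_atTop M)).exists
    obtain ⟨τ', ⟨-, hτ'⟩, he⟩ := Set.mem_iInter.1 hτ n
    have hlm : l m ≤ n := (hM _ ⟨m, rfl⟩).trans hnM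
    have h1 : partialRank τ n (l m) = partialRank τ' n (l m) := by
      rw [← runningRank_rankSeq τ hlm, ← runningRank_rankSeq τ' hlm]
      exact runningRank_congr hlm (rankVec_eq_iff.1 he.symm)
    have h2 : partialRank τ' n (l m) = τ' (l m) := by
      refine partialRank_eq_of_forall_le τ' fun u hu => (hM u ?_).trans hnM
      have h3 : (τ' (l m) : ℕ) ≤ k := (mem_range_of_mem_stemEvent hτ').1 ⟨m, rfl⟩
      exact (mem_range_of_mem_stemEvent hτ').2 (le_trans (PNat.coe_le_coe _ _ |>.2 hu) h3)
    rw [← mem_stemEvent.1 hτ' m]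
    exact PNat.eq (by rw [← hn, h1, h2])
  have hlim := tendsto_measure_iInter_atTop (μ := μ)
    (fun n => (measurableSet_preimage_rankVec n (rankVec n '' A')).nullMeasurableSet) hanti
    ⟨1, measure_ne_top _ _⟩
  exact (ge_of_tendsto hlim (eventually_atTop.2 ⟨M, hle⟩)).trans (measure_mono hsub)

theorem isOrderInvariant_of_isRankUniform {μ : Measure (Equiv.Perm ℕ+)} [IsProbabilityMeasure μ]
    (hae : ∀ᵐ σ ∂μ, IsNaturalExtension r σ) (hμ : ∀ n, IsRankUniform r μ n) :
    IsOrderInvariant r μ where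
  isProbabilityMeasure := inferInstance
  ae_isNaturalExtension := hae
  stem_eq _ _ _ hj hl h := le_antisymm (stemEvent_le_of_isRankUniform hae hμ hj hl h)
    (stemEvent_le_of_isRankUniform hae hμ hl hj h.symm)

lemma measure_preimage_rankVec_le {α : ℕ → ℕ∞} (h1 : (1 : ℕ+) ∉ gaps α)
    {Q : Measure (Equiv.Perm ℕ+)} (hQ : IsOrderInvariant (gapOrder α) Q) (n : ℕ+)
    {σ σ' : Equiv.Perm ℕ+} (hσ' : IsNaturalExtension (gapOrder α) σ') :
    Q (rankVec n ⁻¹' {rankVec n σ}) ≤ Q (rankVec n ⁻¹' {rankVec n σ'}) := by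
  obtain ⟨π, hπ, hpat⟩ := exists_perm_pattern σ σ' n
  have hπinv : ∀ i, n < i → π⁻¹ i = i := fun i hi => inv_apply_eq_self (hπ i hi)
  -- Bounding the first `n` letters by `k` puts all of `1, …, n` into the stem of length `k`, so `π`
  -- preserves the stem's set.
  let X (ρ : Equiv.Perm ℕ+) (k : ℕ) : Set (Equiv.Perm ℕ+) :=
    {τ | rankVec n τ = rankVec n ρ ∧ ∀ i ≤ n, (τ i : ℕ) ≤ k}
  have hX : ∀ k, Q (X σ k) ≤ Q (rankVec n ⁻¹' {rankVec n σ'}) := by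
    intro k
    rw [measure_eq_tsum_stemEvent Q (X σ k) k, measure_eq_tsum_stemEvent Q _ k]
    refine le_trans (ENNReal.tsum_le_tsum (g := fun j : Fin k → ℕ+ =>
      Q (stemEvent (π ∘ j) ∩ rankVec n ⁻¹' {rankVec n σ'})) fun j => ?_)
      (ENNReal.tsum_comp_le_tsum_of_injective (f := fun j : Fin k → ℕ+ => π ∘ j)
        (fun j j' h => funext fun l => π.injective (congrFun h l)) _)
    by_cases hne : ∃ τ, IsNaturalExtension (gapOrder α) τ ∧ τ ∈ stemEvent j ∩ X σ k
    · obtain ⟨τ, hτ, hτj, hτσ, hτk⟩ := hne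
      have hvec : rankVec n (τ * π⁻¹) = rankVec n σ' := by
        rw [rankVec_eq_iff_lt] at hτσ ⊢
        intro u hu v hv
        have hu' := (perm_le_iff hπinv le_rfl u).2 hu
        have hv' := (perm_le_iff hπinv le_rfl v).2 hv
        rw [Equiv.Perm.mul_apply, Equiv.Perm.mul_apply, hτσ _ hu' _ hv', hpat _ hu' _ hv']
        simp
      have hext : IsNaturalExtension (gapOrder α) (τ * π⁻¹) := by
        rw [isNaturalExtension_gapOrder_iff h1] at hτ hσ' ⊢
        intro i
        rcases le_or_gt i n with hi | hi
        · rw [rankVec_eq_iff.1 hvec i hi]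
          exact hσ' i
        · rw [rankSeq_mul_of_lt hπinv hi]
          exact hτ i
      have hmem := mul_inv_mem_stemEvent π hτj
      have hsmall : ∀ i ≤ n, i ∈ Set.range j := fun i hi =>
        (mem_range_of_mem_stemEvent hτj).2 (hτk i hi)
      have hrange : Set.range j = Set.range (π ∘ j) := by
        ext i
        rw [mem_range_of_mem_stemEvent hτj, mem_range_of_mem_stemEvent hmem,
          Equiv.Perm.mul_apply]
        rcases le_or_gt i n with hi | hi
        · exact iff_of_true (hτk i hi) (hτk _ ((perm_le_iff hπinv le_rfl i).2 hi))
        · rw [hπinv i hi]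
      calc Q (stemEvent j ∩ X σ k) ≤ Q (stemEvent j) := measure_mono Set.inter_subset_left
        _ = Q (stemEvent (π ∘ j)) := hQ.stem_eq k j _ ⟨τ, hτ, hτj⟩ ⟨_, hext, hmem⟩ hrange
        _ ≤ Q (stemEvent (π ∘ j) ∩ rankVec n ⁻¹' {rankVec n σ'}) := by
          refine measure_mono fun ρ hρ => ⟨hρ, ?_⟩
          rw [Set.mem_preimage, Set.mem_singleton_iff, ← hvec, rankVec_eq_iff_lt]
          intro u hu v hv
          rw [eqOn_of_mem_stemEvent hρ hmem (hrange ▸ hsmall u hu),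
            eqOn_of_mem_stemEvent hρ hmem (hrange ▸ hsmall v hv)]
    · have h0 : Q (stemEvent j ∩ X σ k) = 0 := by
        refine measure_mono_null (fun τ hτ hc => hne ⟨τ, hc, hτ⟩)
          (ae_iff.1 hQ.ae_isNaturalExtension)
      rw [h0]
      exact zero_le
  have hunion : rankVec n ⁻¹' {rankVec n σ} = ⋃ k, X σ k := by
    ext τ
    simp only [Set.mem_preimage, Set.mem_singleton_iff, Set.mem_iUnion]
    refine ⟨fun h => ⟨(Icc 1 n).sup (fun i => (τ i : ℕ)), h, fun i hi => ?_⟩, fun ⟨k, hk⟩ => hk.1⟩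
    exact le_sup (f := fun i => (τ i : ℕ)) (by simpa using hi)
  have hmono : Monotone (X σ) := fun k k' hk τ hτ => ⟨hτ.1, fun i hi => (hτ.2 i hi).trans hk⟩
  rw [hunion, hmono.measure_iUnion]
  exact iSup_le hX

theorem isRankUniform_of_isOrderInvariant {α : ℕ → ℕ∞} (h1 : (1 : ℕ+) ∉ gaps α)
    {Q : Measure (Equiv.Perm ℕ+)} (hQ : IsOrderInvariant (gapOrder α) Q) (n : ℕ+) :
    IsRankUniform (gapOrder α) Q n := fun _ _ hσ hσ' =>
  le_antisymm (measure_preimage_rankVec_le h1 hQ n hσ') (measure_preimage_rankVec_le h1 hQ n hσ)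

/-- The common mass is the inverse of the number of attained vectors, a quantity independent of the
measure. -/
lemma IsRankUniform.map_rankVec_eq {μ ν : Measure (Equiv.Perm ℕ+)} [IsProbabilityMeasure μ]
    [IsProbabilityMeasure ν] (hμae : ∀ᵐ σ ∂μ, IsNaturalExtension r σ)
    (hνae : ∀ᵐ σ ∂ν, IsNaturalExtension r σ) {n : ℕ+} (hμ : IsRankUniform r μ n)
    (hν : IsRankUniform r ν n) : μ.map (rankVec n) = ν.map (rankVec n) := by
  obtain ⟨σ, hσ⟩ := hμae.exists
  set A := {τ | IsNaturalExtension r τ}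
  have hone : ∀ ρ : Measure (Equiv.Perm ℕ+), IsProbabilityMeasure ρ →
      (∀ᵐ σ ∂ρ, IsNaturalExtension r σ) → IsRankUniform r ρ n →
      (rankVec n '' A).encard * ρ (rankVec n ⁻¹' {rankVec n σ}) = 1 := by
    intro ρ _ hae hρ
    rw [← hρ.measure_preimage_image hσ (A := A) fun τ hτ => hτ]
    refine le_antisymm prob_le_one ?_
    rw [← measure_univ (μ := ρ)]
    refine measure_mono_ae ?_
    filter_upwards [hae] with τ hτ _
    exact ⟨τ, hτ, rfl⟩
  have heq : μ (rankVec n ⁻¹' {rankVec n σ}) = ν (rankVec n ⁻¹' {rankVec n σ}) := by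
    have h1 := hone μ inferInstance hμae hμ
    have h2 := hone ν inferInstance hνae hν
    rw [mul_comm] at h1 h2
    exact (ENNReal.eq_inv_of_mul_eq_one_left h1).trans
      (ENNReal.eq_inv_of_mul_eq_one_left h2).symm
  refine Measure.ext_of_singleton fun s => ?_
  rw [Measure.map_apply (measurable_rankVec n) (measurableSet_singleton s),
    Measure.map_apply (measurable_rankVec n) (measurableSet_singleton s)]
  by_cases hs : ∃ τ, IsNaturalExtension r τ ∧ rankVec n τ = s
  · obtain ⟨τ, hτ, rfl⟩ := hs
    rw [hμ τ σ hτ hσ, hν τ σ hτ hσ, heq]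
  · have hsub : rankVec n ⁻¹' {s} ⊆ {τ | ¬ IsNaturalExtension r τ} :=
      fun τ hτ hc => hs ⟨τ, hc, hτ⟩
    rw [measure_mono_null hsub (ae_iff.1 hμae), measure_mono_null hsub (ae_iff.1 hνae)]

lemma map_rankSeq_eq_of_forall {μ ν : Measure (Equiv.Perm ℕ+)} [IsProbabilityMeasure μ]
    (h : ∀ n, μ.map (rankVec n) = ν.map (rankVec n)) : μ.map rankSeq = ν.map rankSeq := by
  have hI : ∀ I : Finset ℕ+, (μ.map rankSeq).map I.restrict = (ν.map rankSeq).map I.restrict := by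
    intro I
    obtain ⟨n, hn⟩ := I.bddAbove
    have hsub : I ⊆ Icc 1 n := fun i hi => mem_Icc.2 ⟨one_le, hn hi⟩
    have key : ∀ ρ : Measure (Equiv.Perm ℕ+),
        (ρ.map rankSeq).map I.restrict = (ρ.map (rankVec n)).map (restrict₂ (π := fun _ => ℕ) hsub) := by
      intro ρ
      rw [Measure.map_map (by fun_prop) measurable_rankSeq,
        Measure.map_map (by fun_prop) (measurable_rankVec n)]
      rfl
    rw [key, key, h n]
  have := Measure.isProbabilityMeasure_map (μ := μ) measurable_rankSeq.aemeasurable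
  have : ∀ I : Finset ℕ+, IsFiniteMeasure ((μ.map rankSeq).map I.restrict) := inferInstance
  exact IsProjectiveLimit.unique (P := fun I => (μ.map rankSeq).map I.restrict)
    (fun _ => rfl) (fun I => (hI I).symm)

end Uniform

/-! ### Measurability of the reconstruction from ranks -/

section PermOfRanks

lemma exists_rankSeq_eq_iff {r : ℕ+ → ℕ} : (∃ σ : Equiv.Perm ℕ+, rankSeq σ = r) ↔
    (∀ i, 1 ≤ r i ∧ r i ≤ i) ∧ ∀ i, ∃ B, ∀ n, runningRank r i n ≤ B := by
  constructor
  · rintro ⟨σ, rfl⟩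
    refine ⟨fun i => ⟨rankSeq_pos σ i, rankSeq_le σ i⟩, fun i => ⟨σ i, fun n => ?_⟩⟩
    obtain ⟨m, hm, hnm⟩ :=
      ((eventually_runningRank_rankSeq σ i).and (eventually_ge_atTop n)).exists
    rw [← hm]
    exact runningRank_mono _ _ hnm
  · rintro ⟨hr, hb⟩
    exact exists_rankSeq_eq hr hb

lemma rankSeq_permOfRanks {r : ℕ+ → ℕ} (h : ∃ σ : Equiv.Perm ℕ+, rankSeq σ = r) :
    rankSeq (permOfRanks r) = r := by
  rw [permOfRanks, dif_pos h]
  exact h.choose_spec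

lemma measurable_runningRank (i n : ℕ+) : Measurable (fun r : ℕ+ → ℕ => runningRank r i n) := by
  induction n using PNat.recOn with
  | one => exact measurable_pi_apply i
  | succ n ih =>
    simp only [runningRank_succ]
    split_ifs
    · exact ih.add (Measurable.ite (measurableSet_le (measurable_pi_apply _) ih)
        measurable_const measurable_const)
    · exact ih

lemma measurableSet_exists_rankSeq_eq :
    MeasurableSet {r : ℕ+ → ℕ | ∃ σ : Equiv.Perm ℕ+, rankSeq σ = r} := by
  have : {r : ℕ+ → ℕ | ∃ σ : Equiv.Perm ℕ+, rankSeq σ = r} =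
      (⋂ i : ℕ+, {r | 1 ≤ r i} ∩ {r | r i ≤ (i : ℕ)}) ∩ ⋂ i, ⋃ B, ⋂ n, {r | runningRank r i n ≤ B} := by
    ext r
    simp [exists_rankSeq_eq_iff]
  rw [this]
  refine MeasurableSet.inter (.iInter fun i => MeasurableSet.inter ?_ ?_)
    (.iInter fun i => .iUnion fun B => .iInter fun n => ?_)
  · exact measurableSet_le measurable_const (measurable_pi_apply i)
  · exact measurableSet_le (measurable_pi_apply i) measurable_const
  · exact measurableSet_le (measurable_runningRank i n) measurable_const

lemma measurable_permOfRanks : Measurable permOfRanks := by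
  refine measurable_generateFrom ?_
  rintro _ ⟨i, j, rfl⟩
  set V := {r : ℕ+ → ℕ | ∃ σ : Equiv.Perm ℕ+, rankSeq σ = r}
  have hV : MeasurableSet V := measurableSet_exists_rankSeq_eq
  -- On `V` the letter at `i` is the eventual running rank; off `V` the default is the identity.
  have : permOfRanks ⁻¹' {σ | σ i = j} =
      (V ∩ ⋃ N : ℕ+, ⋂ n : ℕ+, ⋂ _ : N ≤ n, {r | runningRank r i n = j}) ∪
        (Vᶜ ∩ {_r | i = j}) := by
    ext r
    by_cases hr : r ∈ V
    · obtain ⟨σ, rfl⟩ := hr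
      have hmem : rankSeq σ ∈ V := ⟨σ, rfl⟩
      simp only [Set.mem_preimage, permOfRanks_rankSeq, Set.mem_ofPred_eq, Set.mem_union,
        Set.mem_iUnion, Set.mem_iInter,
        Set.mem_inter_iff, hmem, true_and, Set.mem_compl_iff, not_true_eq_false, false_and,
        or_false]
      have hev := eventually_runningRank_rankSeq σ i
      constructor
      · rintro rfl
        exact eventually_atTop.1 hev
      · intro h
        obtain ⟨n, h1, h2⟩ := (hev.and (eventually_atTop.2 h)).exists
        exact PNat.eq (h1.symm.trans h2)
    · have h1 : permOfRanks r = 1 := dif_neg hr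
      simp [h1, hr]
  rw [this]
  refine (hV.inter (.iUnion fun N => .iInter fun n => .iInter fun _ => ?_)).union
    (hV.compl.inter (.const _))
  exact measurable_runningRank i n (measurableSet_singleton _)

end PermOfRanks

/-! ### Almost sure boundedness of running ranks -/

section RankLaw

variable (α : ℕ → ℕ∞)

open Classical in
/-- The probability that the `i`-th rank equals a given admissible value smaller than `i`. -/
noncomputable def gapWeight (i : ℕ+) : ℝ≥0∞ :=
  if i ∈ gaps α then (((i : ℕ) - 1 : ℕ) : ℝ≥0∞)⁻¹ else 0

variable {α}

lemma gapWeight_of_mem {i : ℕ+} (h : i ∈ gaps α) :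
    gapWeight α i = (((i : ℕ) - 1 : ℕ) : ℝ≥0∞)⁻¹ := if_pos h

lemma gapWeight_of_notMem {i : ℕ+} (h : i ∉ gaps α) : gapWeight α i = 0 := if_neg h

lemma tsum_gapWeight_lt_top (hsum : (∑' k, ((α k : ℕ∞) : ℝ≥0∞)⁻¹) < ⊤) :
    ∑' i, gapWeight α i < ⊤ := by
  have hk : ∀ g : gaps α, ∃ k, α k = (((g : ℕ+) : ℕ) - 1 : ℕ) := by
    rintro ⟨g, k, hk⟩
    refine ⟨k, ?_⟩
    have hne : α k ≠ ⊤ := fun h => by rw [h, top_add] at hk; exact ENat.natCast_ne_top _ hk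
    lift α k to ℕ using hne with a
    norm_cast at hk ⊢
    simp [hk]
  choose f hf using hk
  have hinj : Function.Injective f := by
    intro g g' h
    have := (hf g).symm.trans ((congrArg α h).trans (hf g'))
    norm_cast at this
    have h1 := (g : ℕ+).pos
    have h2 := (g' : ℕ+).pos
    exact Subtype.ext (PNat.eq (by omega))
  refine lt_of_le_of_lt ?_ hsum
  calc ∑' i, gapWeight α i = ∑' g : gaps α, ((α (f g) : ℕ∞) : ℝ≥0∞)⁻¹ := by
        have h := tsum_subtype (gaps α) (gapWeight α)
        rw [Set.indicator_eq_self.2 (fun i hi => by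
          by_contra hc
          exact hi (gapWeight_of_notMem hc))] at h
        rw [← h]
        refine tsum_congr fun g => ?_
        rw [gapWeight_of_mem g.2, hf]
        simp
    _ ≤ _ := ENNReal.tsum_comp_le_tsum_of_injective hinj _

/-- If all positions beyond `n` were gaps, their weights would form a tail of the harmonic series.
-/
lemma exists_gt_notMem_gaps (hw : ∑' i, gapWeight α i < ⊤) (n : ℕ+) : ∃ b > n, b ∉ gaps α := by
  by_contra! hc
  let f : ℕ → ℕ+ := fun m => n + m.succPNat
  have hinj : Function.Injective f := fun m m' h => by simpa [f] using h
  have h1 : ∑' m, gapWeight α (f m) ≠ ⊤ :=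
    ((ENNReal.tsum_comp_le_tsum_of_injective hinj _).trans_lt hw).ne
  have h2 := ENNReal.summable_toReal h1
  have h3 : (fun m => (gapWeight α (f m)).toReal) = fun m : ℕ => ((m + n : ℕ) : ℝ)⁻¹ := by
    funext m
    rw [gapWeight_of_mem (hc _ (PNat.lt_add_right n _))]
    have : ((f m : ℕ+) : ℕ) - 1 = m + n := by
      simp [f]
      omega
    rw [this, ENNReal.toReal_inv, ENNReal.toReal_natCast]
  rw [h3, summable_nat_add_iff (f := fun m : ℕ => (m : ℝ)⁻¹)] at h2
  exact Real.not_summable_natCast_inv h2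

lemma one_lt_of_mem_gaps (h1 : (1 : ℕ+) ∉ gaps α) {i : ℕ+} (hi : i ∈ gaps α) : 1 < (i : ℕ) := by
  have : i ≠ 1 := fun h => h1 (h ▸ hi)
  exact lt_of_le_of_ne i.pos fun h => this (PNat.eq h.symm)

lemma mem_support_rankPMF (h1 : (1 : ℕ+) ∉ gaps α) {i : ℕ+} {x : ℕ} :
    x ∈ (rankPMF α i).support ↔ 1 ≤ x ∧ x ≤ i ∧ (i ∈ gaps α ↔ x < i) := by
  have := i.pos
  by_cases hi : i ∈ gaps α
  · have h2 := one_lt_of_mem_gaps h1 hi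
    rw [rankPMF, dif_pos ⟨hi, h2⟩, PMF.mem_support_uniformOfFinset_iff]
    simp only [mem_Icc, hi, true_iff]
    omega
  · rw [rankPMF, dif_neg fun h => hi h.1, PMF.support_pure]
    simp only [Set.mem_singleton_iff, hi, false_iff]
    omega

lemma rankPMF_apply_eq {i : ℕ+} {x y : ℕ}
    (hx : x ∈ (rankPMF α i).support) (hy : y ∈ (rankPMF α i).support) :
    rankPMF α i x = rankPMF α i y := by
  unfold rankPMF at *
  split_ifs at * with h
  · rw [PMF.mem_support_uniformOfFinset_iff] at hx hy
    rw [PMF.uniformOfFinset_apply_of_mem _ hx, PMF.uniformOfFinset_apply_of_mem _ hy]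
  · rw [PMF.support_pure, Set.mem_singleton_iff] at hx hy
    rw [hx, hy]

lemma rankPMF_le_toMeasure_le (h1 : (1 : ℕ+) ∉ gaps α) {i : ℕ+} {v : ℕ} (hv : v < i) :
    (rankPMF α i).toMeasure {x | x ≤ v} ≤ gapWeight α i * v := by
  classical
  by_cases hi : i ∈ gaps α
  · have h2 := one_lt_of_mem_gaps h1 hi
    rw [rankPMF, dif_pos ⟨hi, h2⟩, PMF.toMeasure_uniformOfFinset_apply _ _ (.of_discrete),
      gapWeight_of_mem hi, mul_comm, ENNReal.div_eq_inv_mul, mul_comm, Nat.card_Icc,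
      Nat.add_sub_cancel]
    gcongr
    refine (card_le_card (t := Icc 1 v) fun x hx => ?_).trans (by simp)
    simp only [mem_filter, mem_Icc, Set.mem_ofPred_eq] at hx ⊢
    omega
  · rw [rankPMF, dif_neg fun h => hi h.1, PMF.toMeasure_pure_apply _ _ (.of_discrete),
      if_neg (by simpa using hv)]
    exact zero_le

instance isProbabilityMeasure_rankLaw : IsProbabilityMeasure (rankLaw α) := by
  unfold rankLaw
  infer_instance

lemma rankLaw_map_eval (i : ℕ+) : (rankLaw α).map (fun r => r i) = (rankPMF α i).toMeasure :=
  Measure.infinitePi_map_eval _ i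

lemma ae_mem_support_rankPMF : ∀ᵐ r ∂rankLaw α, ∀ i, r i ∈ (rankPMF α i).support := by
  refine ae_all_iff.2 fun i => ?_
  have h : ∀ᵐ x ∂((rankLaw α).map (fun r => r i)), x ∈ (rankPMF α i).support := by
    rw [rankLaw_map_eval, ae_iff, PMF.toMeasure_apply_eq_zero_iff _ .of_discrete]
    exact Set.disjoint_left.2 fun x hx hc => hc hx
  exact ae_of_ae_map (measurable_pi_apply i).aemeasurable h

lemma indepFun_runningRank (i n : ℕ+) (hi : i ≤ n) :
    ProbabilityTheory.IndepFun (fun r : ℕ+ → ℕ => runningRank r i n) (fun r => r (n + 1))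
      (rankLaw α) := by
  have h := ProbabilityTheory.iIndepFun_infinitePi (P := fun i => (rankPMF α i).toMeasure)
    (X := fun _ x => x) (fun _ => measurable_id)
  have h2 := h.indepFun_finset (Icc 1 n) {n + 1}
    (disjoint_singleton_right.2 (succ_notMem_Icc_one n)) (fun i => measurable_pi_apply i)
  -- The default `0` beyond `n` is never read by the running rank at time `n`.
  let F : (Icc 1 n → ℕ) → ℕ := fun x =>
    runningRank (fun m => if h : m ∈ Icc 1 n then x ⟨m, h⟩ else 0) i n
  have h3 := h2.comp (φ := F) (ψ := fun y => y ⟨n + 1, mem_singleton_self _⟩) .of_discrete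
    .of_discrete
  refine h3.congr (.of_forall fun r => ?_) (.of_forall fun r => rfl)
  change runningRank (fun m => if h : m ∈ Icc 1 n then r m else 0) i n = runningRank r i n
  refine runningRank_congr hi fun m hm => ?_
  simp [hm]

/-- Given running rank `v`, the independent next rank is at most `v` with probability at most
`gapWeight α (n + 1) * v`; sum over `v`. -/
lemma lintegral_runningRank_succ_le (h1 : (1 : ℕ+) ∉ gaps α) {i n : ℕ+} (hi : i ≤ n) :
    ∫⁻ r, (runningRank r i (n + 1) : ℝ≥0∞) ∂rankLaw α ≤
      (∫⁻ r, (runningRank r i n : ℝ≥0∞) ∂rankLaw α) * (1 + gapWeight α (n + 1)) := by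
  have hm := measurable_runningRank i n
  have hE : MeasurableSet {r : ℕ+ → ℕ | r (n + 1) ≤ runningRank r i n} :=
    measurableSet_le (measurable_pi_apply _) hm
  have hsplit : ∀ r : ℕ+ → ℕ, (runningRank r i (n + 1) : ℝ≥0∞) = runningRank r i n +
      {r : ℕ+ → ℕ | r (n + 1) ≤ runningRank r i n}.indicator 1 r := by
    intro r
    rw [runningRank_succ, if_pos hi, Set.indicator_apply]
    push_cast
    rfl
  have hint : ∫⁻ r, (runningRank r i n : ℝ≥0∞) ∂rankLaw α =
      ∑' v : ℕ, (v : ℝ≥0∞) * rankLaw α {r | runningRank r i n = v} := by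
    rw [← lintegral_map (f := fun v : ℕ => (v : ℝ≥0∞)) .of_discrete hm, lintegral_countable']
    refine tsum_congr fun v => ?_
    rw [Measure.map_apply hm (measurableSet_singleton v)]
    rfl
  have hmain : rankLaw α {r | r (n + 1) ≤ runningRank r i n} ≤
      gapWeight α (n + 1) * ∫⁻ r, (runningRank r i n : ℝ≥0∞) ∂rankLaw α := by
    rw [hint, ← ENNReal.tsum_mul_left]
    have hcover : {r : ℕ+ → ℕ | r (n + 1) ≤ runningRank r i n} ⊆
        ⋃ v : ℕ, {r | runningRank r i n = v} ∩ {r | r (n + 1) ≤ v} := fun r hr =>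
      Set.mem_iUnion.2 ⟨runningRank r i n, rfl, hr⟩
    refine (measure_mono hcover).trans ((measure_iUnion_le _).trans
      (ENNReal.tsum_le_tsum fun v => ?_))
    rcases le_or_gt v n with hv | hv
    · have hind := (indepFun_runningRank (α := α) i n hi).measure_inter_preimage_eq_mul {v}
        {x | x ≤ v} .of_discrete .of_discrete
      have hlaw : rankLaw α ((fun r => r (n + 1)) ⁻¹' {x | x ≤ v}) ≤
          gapWeight α (n + 1) * v := by
        rw [← Measure.map_apply (measurable_pi_apply _) .of_discrete, rankLaw_map_eval]
        exact rankPMF_le_toMeasure_le h1 (by rw [PNat.add_coe, PNat.one_coe]; omega)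
      calc _ = _ := hind
        _ ≤ rankLaw α {r | runningRank r i n = v} * (gapWeight α (n + 1) * v) := by
          gcongr
          exact subset_rfl
        _ = _ := by ring
    · have h0 : rankLaw α ({r | runningRank r i n = v} ∩ {r | r (n + 1) ≤ v}) = 0 := by
        refine measure_mono_null (t := {r | ¬ ∀ i, r i ∈ (rankPMF α i).support})
          (fun r hr hc => ?_) (ae_iff.1 ae_mem_support_rankPMF)
        have hadm : ∀ m, 1 ≤ r m ∧ r m ≤ m := fun m =>
          have := (mem_support_rankPMF h1).1 (hc m)
          ⟨this.1, this.2.1⟩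
        have := runningRank_le hadm hi
        rw [hr.1] at this
        omega
      rw [h0]
      exact zero_le
  simp only [hsplit]
  rw [lintegral_add_left (by fun_prop), lintegral_indicator_one hE, mul_add, mul_one,
    mul_comm _ (gapWeight α (n + 1))]
  gcongr

lemma lintegral_runningRank_le_prod (h1 : (1 : ℕ+) ∉ gaps α) (i n : ℕ+) :
    ∫⁻ r, (runningRank r i n : ℝ≥0∞) ∂rankLaw α ≤
      (i : ℕ) * ∏ m ∈ Icc 1 n, (1 + gapWeight α m) := by
  have hbase : ∀ n ≤ i, ∫⁻ r, (runningRank r i n : ℝ≥0∞) ∂rankLaw α ≤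
      (i : ℕ) * ∏ m ∈ Icc 1 n, (1 + gapWeight α m) := by
    intro n hn
    calc ∫⁻ r, (runningRank r i n : ℝ≥0∞) ∂rankLaw α ≤ ∫⁻ _, ((i : ℕ) : ℝ≥0∞) ∂rankLaw α := by
          refine lintegral_mono_ae ?_
          filter_upwards [ae_mem_support_rankPMF (α := α)] with r hr
          rw [runningRank_of_le r hn]
          exact_mod_cast ((mem_support_rankPMF h1).1 (hr i)).2.1
      _ = (i : ℕ) * 1 := by simp
      _ ≤ _ := by
          gcongr
          exact one_le_prod' fun m _ => le_self_add
  induction n using PNat.recOn with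
  | one => exact hbase 1 one_le
  | succ n ih =>
    rcases le_or_gt i n with hi | hi
    · refine (lintegral_runningRank_succ_le h1 hi).trans ?_
      rw [Icc_one_succ, prod_insert (succ_notMem_Icc_one n), mul_comm (1 + _), ← mul_assoc]
      gcongr
    · exact hbase _ (PNat.add_one_le_iff.2 hi)

lemma prod_one_add_le_exp {ι : Type*} (w : ι → ℝ≥0∞) (hw : ∑' i, w i < ⊤) (s : Finset ι) :
    ∏ i ∈ s, (1 + w i) ≤ ENNReal.ofReal (Real.exp (∑' i, w i).toReal) := by
  have hfin : ∀ i, w i ≠ ⊤ := ENNReal.ne_top_of_tsum_ne_top hw.ne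
  calc ∏ i ∈ s, (1 + w i) ≤ ∏ i ∈ s, ENNReal.ofReal (Real.exp (w i).toReal) := by
        gcongr with i
        rw [← ENNReal.ofReal_toReal (ENNReal.add_ne_top.2 ⟨ENNReal.one_ne_top, hfin i⟩)]
        refine ENNReal.ofReal_le_ofReal ?_
        rw [ENNReal.toReal_add ENNReal.one_ne_top (hfin i), ENNReal.toReal_one, add_comm]
        exact Real.add_one_le_exp _
    _ = ENNReal.ofReal (Real.exp (∑ i ∈ s, w i).toReal) := by
        rw [← ENNReal.ofReal_prod_of_nonneg fun i _ => (Real.exp_pos _).le, ← Real.exp_sum,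
          ENNReal.toReal_sum fun i _ => hfin i]
    _ ≤ _ := by
        gcongr
        · exact hw.ne
        · exact ENNReal.sum_le_tsum s

/-- By monotone convergence the supremum over `n` has finite expectation. -/
lemma ae_bounded_runningRank (h1 : (1 : ℕ+) ∉ gaps α) (hw : ∑' i, gapWeight α i < ⊤) :
    ∀ᵐ r ∂rankLaw α, ∀ i, ∃ B, ∀ n, runningRank r i n ≤ B := by
  refine ae_all_iff.2 fun i => ?_
  have hmeas : ∀ n, Measurable fun r : ℕ+ → ℕ => (runningRank r i n : ℝ≥0∞) := fun n =>
    Measurable.of_discrete.comp (measurable_runningRank i n)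
  have hle : ∫⁻ r, ⨆ n, (runningRank r i n : ℝ≥0∞) ∂rankLaw α < ⊤ := by
    rw [lintegral_iSup_directed (fun n => (hmeas n).aemeasurable)
      (Monotone.directed_le fun m n hmn r => by
        exact_mod_cast runningRank_mono r i hmn)]
    refine lt_of_le_of_lt (iSup_le fun n => (lintegral_runningRank_le_prod h1 i n).trans
      (mul_le_mul_right (prod_one_add_le_exp _ hw _) _)) ?_
    exact ENNReal.mul_lt_top (ENNReal.natCast_lt_top _) ENNReal.ofReal_lt_top
  filter_upwards [ae_lt_top (Measurable.iSup hmeas) hle.ne] with r hr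
  obtain ⟨B, hB⟩ := ENNReal.exists_nat_gt hr.ne
  exact ⟨B, fun n => by exact_mod_cast (le_iSup (fun n => (runningRank r i n : ℝ≥0∞)) n).trans hB.le⟩

theorem ae_exists_rankSeq_eq (h1 : (1 : ℕ+) ∉ gaps α) (hw : ∑' i, gapWeight α i < ⊤) :
    ∀ᵐ r ∂rankLaw α, ∃ σ : Equiv.Perm ℕ+, rankSeq σ = r := by
  filter_upwards [ae_mem_support_rankPMF, ae_bounded_runningRank h1 hw] with r hr hb
  refine exists_rankSeq_eq (fun i => ?_) hb
  have := (mem_support_rankPMF h1).1 (hr i)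
  exact ⟨this.1, this.2.1⟩

end RankLaw

/-! ### Order-invariance and uniqueness of the record measure -/

section RecordMeasure

variable {α : ℕ → ℕ∞}

instance isProbabilityMeasure_recordMeasure : IsProbabilityMeasure (recordMeasure α) :=
  Measure.isProbabilityMeasure_map measurable_permOfRanks.aemeasurable

lemma map_rankSeq_recordMeasure (h1 : (1 : ℕ+) ∉ gaps α) (hw : ∑' i, gapWeight α i < ⊤) :
    (recordMeasure α).map rankSeq = rankLaw α := by
  rw [recordMeasure, Measure.map_map measurable_rankSeq measurable_permOfRanks]
  conv_rhs => rw [← Measure.map_id (μ := rankLaw α)]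
  refine Measure.map_congr ?_
  filter_upwards [ae_exists_rankSeq_eq h1 hw] with r hr
  exact rankSeq_permOfRanks hr

lemma ae_isNaturalExtension_recordMeasure (h1 : (1 : ℕ+) ∉ gaps α)
    (hw : ∑' i, gapWeight α i < ⊤) :
    ∀ᵐ σ ∂recordMeasure α, IsNaturalExtension (gapOrder α) σ := by
  have h : ∀ᵐ r ∂(recordMeasure α).map rankSeq, ∀ i, r i ∈ (rankPMF α i).support := by
    rw [map_rankSeq_recordMeasure h1 hw]
    exact ae_mem_support_rankPMF
  filter_upwards [ae_of_ae_map measurable_rankSeq.aemeasurable h] with σ hσ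
  rw [isNaturalExtension_gapOrder_iff h1]
  exact fun i => ((mem_support_rankPMF h1).1 (hσ i)).2.2

lemma isRankUniform_recordMeasure (h1 : (1 : ℕ+) ∉ gaps α) (hw : ∑' i, gapWeight α i < ⊤)
    (n : ℕ+) : IsRankUniform (gapOrder α) (recordMeasure α) n := by
  have hsupp : ∀ σ, IsNaturalExtension (gapOrder α) σ → ∀ i,
      rankSeq σ i ∈ (rankPMF α i).support := fun σ hσ i =>
    (mem_support_rankPMF h1).2 ⟨rankSeq_pos σ i, rankSeq_le σ i,
      (isNaturalExtension_gapOrder_iff h1).1 hσ i⟩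
  have hprod : ∀ σ, recordMeasure α (rankVec n ⁻¹' {rankVec n σ}) =
      ∏ i ∈ Icc 1 n, rankPMF α i (rankSeq σ i) := by
    intro σ
    have hset : rankVec n ⁻¹' {rankVec n σ} =
        rankSeq ⁻¹' (Set.pi (Icc 1 n : Finset ℕ+) fun i => {rankSeq σ i}) := by
      ext τ
      simp [rankVec_eq_iff, Set.mem_pi]
    rw [hset, ← Measure.map_apply measurable_rankSeq
      (.pi (Set.to_countable _) fun _ _ => .of_discrete), map_rankSeq_recordMeasure h1 hw, rankLaw,
      Measure.infinitePi_pi _ fun _ _ => .of_discrete]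
    refine prod_congr rfl fun i _ => ?_
    rw [PMF.toMeasure_apply_singleton _ _ .of_discrete]
  intro σ σ' hσ hσ'
  rw [hprod, hprod]
  exact prod_congr rfl fun i _ => rankPMF_apply_eq (hsupp σ hσ i) (hsupp σ' hσ' i)

theorem isOrderInvariant_recordMeasure (h1 : (1 : ℕ+) ∉ gaps α)
    (hw : ∑' i, gapWeight α i < ⊤) : IsOrderInvariant (gapOrder α) (recordMeasure α) :=
  isOrderInvariant_of_isRankUniform (ae_isNaturalExtension_recordMeasure h1 hw)
    (isRankUniform_recordMeasure h1 hw)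

/-- The law of the ranks determines `Q`, because `permOfRanks` is a measurable left inverse of
`rankSeq`. -/
theorem eq_recordMeasure_of_isOrderInvariant (h1 : (1 : ℕ+) ∉ gaps α)
    (hw : ∑' i, gapWeight α i < ⊤) {Q : Measure (Equiv.Perm ℕ+)}
    (hQ : IsOrderInvariant (gapOrder α) Q) : Q = recordMeasure α := by
  have := hQ.isProbabilityMeasure
  have hmap : Q.map rankSeq = rankLaw α := by
    rw [← map_rankSeq_recordMeasure h1 hw]
    exact map_rankSeq_eq_of_forall fun n =>
      (isRankUniform_of_isOrderInvariant h1 hQ n).map_rankVec_eq hQ.ae_isNaturalExtension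
        (ae_isNaturalExtension_recordMeasure h1 hw) (isRankUniform_recordMeasure h1 hw n)
  rw [recordMeasure, ← hmap, Measure.map_map measurable_permOfRanks measurable_rankSeq]
  conv_lhs => rw [← Measure.map_id (μ := Q)]
  congr 1
  exact funext fun σ => (permOfRanks_rankSeq σ).symm

end RecordMeasure

end CausalRecords

theorem mainTheorem5 (α : ℕ → ℕ∞) (hpos : ∀ k, 1 ≤ α k)
    (hmono : ∀ k l, k < l → α k < α l ∨ α l = ⊤)
    (hsum : (∑' k, ((α k : ℕ∞) : ℝ≥0∞)⁻¹) < ⊤) :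
    CausalRecords.IsCausalSet (CausalRecords.gapOrder α) ∧
    (∀ᵐ r ∂(CausalRecords.rankLaw α),
      ∃! σ : Equiv.Perm ℕ+, CausalRecords.rankSeq σ = r) ∧
    CausalRecords.IsOrderInvariant (CausalRecords.gapOrder α) (CausalRecords.recordMeasure α) ∧
    ∀ Q : Measure (Equiv.Perm ℕ+),
      CausalRecords.IsOrderInvariant (CausalRecords.gapOrder α) Q →
        Q = CausalRecords.recordMeasure α := by
  have h1 := CausalRecords.one_notMem_gaps hpos
  have hw := CausalRecords.tsum_gapWeight_lt_top hsum
  refine ⟨CausalRecords.isCausalSet_gapOrder (CausalRecords.exists_gt_notMem_gaps hw), ?_,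
    CausalRecords.isOrderInvariant_recordMeasure h1 hw,
    fun Q hQ => CausalRecords.eq_recordMeasure_of_isOrderInvariant h1 hw hQ⟩
  filter_upwards [CausalRecords.ae_exists_rankSeq_eq h1 hw] with r hr
  obtain ⟨σ, rfl⟩ := hr
  exact ⟨σ, rfl, fun τ hτ => CausalRecords.rankSeq_injective hτ⟩
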